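/- Let $p$ be a prime, $n\ge 0$, let $F_n$ be the (discrete) free group on $x_1,\dots,x_n$, and let $F(n)$ be the free pro-$p$ group on $x_1,\dots,x_n$, i.e. the completion of $F_n$ with respect to its normal subgroups of $p$-power index. For a profinite group $G$ let $\mathbf Z_p[[G]]=\varprojlim_U \mathbf Z_p[G/U]$ ($U$ running over the open normal subgroups of $G$) be the completed group ring over the $p$-adic integers with its inverse limit topology. Let $D_1,\dots,D_n$ be the Fox derivatives of $\mathbf Z[F_n]$, i.e. the additive maps $\mathbf Z[F_n]\to\mathbf Z[F_n]$ with $D_k(uv)=D_k(u)v+\varepsilon(u)D_k(v)$ ($\varepsilon$ the augmentation), $D_k(x_k)=1$ and $D_k(x_j)=0$ for $j\ne k$, and let $\partial_1,\dots,\partial_n$ be their (unique) continuous extensions to $\mathbf Z_p[[F(n)]]$. Let $K\subseteq\{1,\dots,n\}$, let $F(K)\subseteq F(n)$ be the free pro-$p$ group on $\{x_j\mid j\in K\}$, viewed as the closed subgroup of $F(n)$ generated by these $x_j$, let $N$ be a closed normal subgroup of $F(n)$, and let $\pi:\mathbf Z_p[[F(n)]]\to\mathbf Z_p[[F(n)/N]]$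 be the homomorphism induced by the natural homomorphism $F(n)\to F(n)/N$. Let $v\in F(n)$. If $$\pi(\partial_k(v))=0\quad\text{for all }k\in\{1,\dots,n\}\setminus K,$$ then $v$ belongs to the closure in $F(n)$ of the product $F(K)\,(F(K)\cap N)^{F(n)}\,[N,N]$, where $(F(K)\cap N)^{F(n)}$ is the normal subgroup of $F(n)$ generated by $F(K)\cap N$ and $[N,N]$ is the subgroup generated by all commutators of elements of $N$. -/

import Mathlib

open scoped Pointwise

noncomputable section

/-- The projection `G ⧸ M → G ⧸ N` for normal subgroups `M ≤ N`. -/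
def quotProj {G : Type*} [Group G] {M N : Subgroup G} [M.Normal] [N.Normal] (h : M ≤ N) :
    G ⧸ M →* G ⧸ N :=
  QuotientGroup.map M N (MonoidHom.id G) (h.trans_eq (Subgroup.comap_id N).symm)

/-! ### Pro-`p` completions and free pro-`p` groups -/

/-- The normal subgroups of `G` whose index is a power of `p`. -/
def PPowNormal (p : ℕ) (G : Type*) [Group G] : Type _ :=
  {N : Subgroup G // N.Normal ∧ ∃ k : ℕ, N.index = p ^ k}

instance (p : ℕ) (G : Type*) [Group G] (N : PPowNormal p G) : N.1.Normal := N.2.1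

/-- The quotient `G ⧸ N` by a normal subgroup of `p`-power index, with the discrete topology. -/
def PQuotient (p : ℕ) (G : Type*) [Group G] (N : PPowNormal p G) : Type _ := G ⧸ N.1

instance (p : ℕ) (G : Type*) [Group G] (N : PPowNormal p G) : Group (PQuotient p G N) :=
  inferInstanceAs (Group (G ⧸ N.1))

instance (p : ℕ) (G : Type*) [Group G] (N : PPowNormal p G) :
    TopologicalSpace (PQuotient p G N) := ⊥

instance (p : ℕ) (G : Type*) [Group G] (N : PPowNormal p G) :
    DiscreteTopology (PQuotient p G N) := ⟨rfl⟩

/-- The projection `G ⧸ M → G ⧸ N` for `M ≤ N`. -/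
def PQuotient.proj {p : ℕ} {G : Type*} [Group G] {M N : PPowNormal p G} (h : M.1 ≤ N.1) :
    PQuotient p G M →* PQuotient p G N :=
  quotProj h

/-- The compatible families in the product of the quotients of `G` by its normal subgroups of
`p`-power index. -/
def proPCompletion (p : ℕ) (G : Type*) [Group G] :
    Subgroup ((N : PPowNormal p G) → PQuotient p G N) where
  carrier := {f | ∀ (M N : PPowNormal p G) (h : M.1 ≤ N.1), PQuotient.proj h (f M) = f N}
  mul_mem' := fun ha hb M N h => by simp [ha M N h, hb M N h]
  one_mem' := fun M N h => by simp
  inv_mem' := fun ha M N h => by simp [ha M N h]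

/-- The pro-`p` completion of `G`: the inverse limit of the quotients of `G` by its normal
subgroups of `p`-power index, a topological group for the inverse limit topology. -/
abbrev ProPCompletion (p : ℕ) (G : Type*) [Group G] : Type _ := proPCompletion p G

/-- The canonical homomorphism from `G` to its pro-`p` completion. -/
def ProPCompletion.of (p : ℕ) (G : Type*) [Group G] : G →* ProPCompletion p G where
  toFun g := ⟨fun N => QuotientGroup.mk' N.1 g, fun _ _ _ => rfl⟩
  map_one' := rfl
  map_mul' _ _ := rfl

/-- The free pro-`p` group on `x_0, …, x_{n-1}`: the pro-`p` completion of the free group. -/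
abbrev FreeProP (p n : ℕ) : Type := ProPCompletion p (FreeGroup (Fin n))

/-- The free generators of the free pro-`p` group. -/
def FreeProP.gen (p n : ℕ) (k : Fin n) : FreeProP p n :=
  ProPCompletion.of p (FreeGroup (Fin n)) (FreeGroup.of k)

/-- The free pro-`p` group on `{x_k | k ∈ K}`, as a closed subgroup of the free pro-`p` group on
all generators: the closed subgroup generated by the `x_k`, `k ∈ K`. -/
def FreeProP.sub (p n : ℕ) (K : Set (Fin n)) : Subgroup (FreeProP p n) :=
  (Subgroup.closure (FreeProP.gen p n '' K)).topologicalClosure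

/-! ### Completed group rings -/

section CompletedGroupRing

variable (p : ℕ) [Fact p.Prime]

/-- The compatible families in the product of the group rings `ℤ_p[G ⧸ U]`, `U` open normal. -/
def completedGroupRing (G : Type*) [Group G] [TopologicalSpace G] :
    Subring ((U : OpenNormalSubgroup G) → MonoidAlgebra ℤ_[p] (G ⧸ U.toSubgroup)) where
  carrier := {f | ∀ (U V : OpenNormalSubgroup G) (h : U.toSubgroup ≤ V.toSubgroup),
    MonoidAlgebra.mapDomainRingHom ℤ_[p] (quotProj h) (f U) = f V}
  mul_mem' := fun ha hb U V h => by
    rw [Pi.mul_apply, map_mul, ha U V h, hb U V h, Pi.mul_apply]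
  one_mem' := fun U V h => by rw [Pi.one_apply, map_one, Pi.one_apply]
  add_mem' := fun ha hb U V h => by
    rw [Pi.add_apply, map_add, ha U V h, hb U V h, Pi.add_apply]
  zero_mem' := fun U V h => by rw [Pi.zero_apply, map_zero, Pi.zero_apply]
  neg_mem' := fun ha U V h => by rw [Pi.neg_apply, map_neg, ha U V h, Pi.neg_apply]

/-- The completed group ring `ℤ_p[[G]]`: the inverse limit of the group rings `ℤ_p[G ⧸ U]`, where
`U` runs through the open normal subgroups of `G`. -/
abbrev CompletedGroupRing (G : Type*) [Group G] [TopologicalSpace G] : Type _ :=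
  completedGroupRing p G

/-- All the coefficients of an element of the completed group ring. -/
def CompletedGroupRing.coeffs (G : Type*) [Group G] [TopologicalSpace G]
    (a : CompletedGroupRing p G) (U : OpenNormalSubgroup G) (x : G ⧸ U.toSubgroup) : ℤ_[p] :=
  (a.1 U).coeff x

/-- The inverse limit topology, where `ℤ_p[G ⧸ U]` has the topology of coefficientwise `p`-adic
convergence. -/
instance (G : Type*) [Group G] [TopologicalSpace G] : TopologicalSpace (CompletedGroupRing p G) :=
  TopologicalSpace.induced (CompletedGroupRing.coeffs p G) inferInstance

/-- The canonical map from a topological group to its completed group ring. -/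
def CompletedGroupRing.of (G : Type*) [Group G] [TopologicalSpace G] :
    G →* CompletedGroupRing p G where
  toFun g := ⟨fun U => MonoidAlgebra.single (QuotientGroup.mk' U.toSubgroup g) 1,
    fun U V h => by simp [quotProj]⟩
  map_one' := rfl
  map_mul' g h := by
    apply Subtype.ext
    funext U
    simp [MonoidAlgebra.single_mul_single]

/-- The preimage of an open normal subgroup under a continuous homomorphism. -/
def OpenNormalSubgroup.preimage {G H : Type*} [Group G] [TopologicalSpace G] [Group H]
    [TopologicalSpace H] (φ : G →* H) (hφ : Continuous φ) (V : OpenNormalSubgroup H) :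
    OpenNormalSubgroup G where
  toOpenSubgroup := V.toOpenSubgroup.comap φ hφ
  isNormal' := inferInstanceAs (V.toSubgroup.comap φ).Normal

/-- The ring homomorphism `ℤ_p[[G]] → ℤ_p[[H]]` induced by a continuous homomorphism `G → H`. -/
def CompletedGroupRing.map {G H : Type*} [Group G] [TopologicalSpace G] [Group H]
    [TopologicalSpace H] (φ : G →* H) (hφ : Continuous φ) :
    CompletedGroupRing p G →+* CompletedGroupRing p H where
  toFun a := ⟨fun V => MonoidAlgebra.mapDomainRingHom ℤ_[p]
      (QuotientGroup.map (V.preimage φ hφ).toSubgroup V.toSubgroup φ le_rfl)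
      (a.1 (V.preimage φ hφ)), fun V W h => by
    have h' : (V.preimage φ hφ).toSubgroup ≤ (W.preimage φ hφ).toSubgroup :=
      Subgroup.comap_mono h
    have hc : (quotProj h).comp (QuotientGroup.map (V.preimage φ hφ).toSubgroup V.toSubgroup φ
        le_rfl) = (QuotientGroup.map (W.preimage φ hφ).toSubgroup W.toSubgroup φ le_rfl).comp
        (quotProj h') := by
      ext x
      rfl
    change MonoidAlgebra.mapDomainRingHom ℤ_[p] _ (MonoidAlgebra.mapDomainRingHom ℤ_[p] _ _) =
      MonoidAlgebra.mapDomainRingHom ℤ_[p] _ _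
    rw [← a.2 _ _ h', ← RingHom.comp_apply, ← RingHom.comp_apply,
      ← MonoidAlgebra.mapDomainRingHom_comp, ← MonoidAlgebra.mapDomainRingHom_comp, hc]⟩
  map_one' := by apply Subtype.ext; funext V; exact map_one _
  map_mul' a b := by apply Subtype.ext; funext V; exact map_mul _ _ _
  map_zero' := by apply Subtype.ext; funext V; exact map_zero _
  map_add' a b := by apply Subtype.ext; funext V; exact map_add _ _ _

/-- The homomorphism `π : ℤ_p[[G]] → ℤ_p[[G ⧸ N]]` induced by `G → G ⧸ N`. -/
def CompletedGroupRing.quotientMap {G : Type*} [Group G] [TopologicalSpace G]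
    (N : Subgroup G) [N.Normal] : CompletedGroupRing p G →+* CompletedGroupRing p (G ⧸ N) :=
  CompletedGroupRing.map p (QuotientGroup.mk' N) continuous_quotient_mk'

end CompletedGroupRing

/-! ### Fox derivatives of the integral group ring of a free group -/

section Fox

variable {α : Type*} [DecidableEq α]

/-- The representation of the free group by matrices `!![f, 0; D_k f, 1]` over its group ring. -/
def foxRep (k : α) :
    FreeGroup α →* (Matrix (Fin 2) (Fin 2) (MonoidAlgebra ℤ (FreeGroup α)))ˣ :=
  FreeGroup.lift fun j =>
    { val := !![MonoidAlgebra.single (FreeGroup.of j) 1, 0; if j = k then 1 else 0, 1]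
      inv := !![MonoidAlgebra.single (FreeGroup.of j)⁻¹ 1, 0;
        if j = k then -MonoidAlgebra.single (FreeGroup.of j)⁻¹ 1 else 0, 1]
      val_inv := by
        split_ifs <;>
        simp [Matrix.one_fin_two, MonoidAlgebra.single_mul_single, MonoidAlgebra.one_def]
      inv_val := by
        split_ifs <;>
        simp [Matrix.one_fin_two, MonoidAlgebra.single_mul_single, MonoidAlgebra.one_def] }

/-- The Fox derivative `D_k` on elements of the free group. -/
def foxWord (k : α) (f : FreeGroup α) : MonoidAlgebra ℤ (FreeGroup α) :=
  (foxRep k f : Matrix (Fin 2) (Fin 2) (MonoidAlgebra ℤ (FreeGroup α))) 1 0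

/-- The Fox derivative `D_k` of the integral group ring of the free group, the additive extension
of `foxWord`. It is characterized by `foxD_mul` (with `ε` the augmentation) and `foxD_of`. -/
def foxD (k : α) : MonoidAlgebra ℤ (FreeGroup α) →+ MonoidAlgebra ℤ (FreeGroup α) :=
  (Finsupp.liftAddHom fun f => zmultiplesHom _ (foxWord k f)).comp
    MonoidAlgebra.coeffAddEquiv.toAddMonoidHom

/-- The augmentation `ε`. -/
def fgAugmentation : MonoidAlgebra ℤ (FreeGroup α) →+* ℤ :=
  (MonoidAlgebra.lift ℤ ℤ (FreeGroup α) 1).toRingHom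

theorem foxD_single (k : α) (f : FreeGroup α) (c : ℤ) :
    foxD k (MonoidAlgebra.single f c) = c • foxWord k f := by
  simp [foxD]

theorem foxRep_apply (k : α) (f : FreeGroup α) :
    (foxRep k f : Matrix (Fin 2) (Fin 2) (MonoidAlgebra ℤ (FreeGroup α))) =
      !![MonoidAlgebra.single f 1, 0; foxWord k f, 1] := by
  have key : ∀ f : FreeGroup α,
      (foxRep k f : Matrix (Fin 2) (Fin 2) (MonoidAlgebra ℤ (FreeGroup α))) 0 0 =
        MonoidAlgebra.single f 1 ∧
      (foxRep k f : Matrix (Fin 2) (Fin 2) (MonoidAlgebra ℤ (FreeGroup α))) 0 1 = 0 ∧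
      (foxRep k f : Matrix (Fin 2) (Fin 2) (MonoidAlgebra ℤ (FreeGroup α))) 1 1 = 1 := by
    intro f
    induction f using FreeGroup.induction_on with
    | C1 => simp [MonoidAlgebra.one_def]
    | of j => simp [foxRep]
    | inv_of j _ => simp [foxRep]
    | mul x y hx hy =>
      simp [Matrix.mul_apply, hx, hy, MonoidAlgebra.single_mul_single]
  obtain ⟨h1, h2, h3⟩ := key f
  ext i j : 2
  fin_cases i <;> fin_cases j <;> simp [h1, h2, h3, foxWord]

theorem foxWord_mul (k : α) (f g : FreeGroup α) :
    foxWord k (f * g) = foxWord k f * MonoidAlgebra.single g 1 + foxWord k g := by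
  conv_lhs => rw [foxWord, map_mul, Units.val_mul, foxRep_apply k f, foxRep_apply k g]
  simp

/-- `D_k` is a derivation: `D_k(uv) = D_k(u) v + ε(u) D_k(v)`. -/
theorem foxD_mul (k : α) (u v : MonoidAlgebra ℤ (FreeGroup α)) :
    foxD k (u * v) = foxD k u * v + fgAugmentation u • foxD k v := by
  induction u using MonoidAlgebra.induction_linear with
  | zero => simp
  | add x y hx hy => rw [add_mul, map_add, hx, hy, map_add, map_add, add_mul, add_smul]; abel
  | single f c =>
    induction v using MonoidAlgebra.induction_linear with
    | zero => simp
    | add x y hx hy => rw [mul_add, map_add, hx, hy, map_add, mul_add, smul_add]; abel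
    | single g d =>
      have : (MonoidAlgebra.single g d : MonoidAlgebra ℤ (FreeGroup α)) =
        d • MonoidAlgebra.single g 1 := by simp
      rw [MonoidAlgebra.single_mul_single, foxD_single, foxD_single, foxD_single, foxWord_mul,
        this, smul_mul_smul_comm, smul_add]
      simp [fgAugmentation, mul_smul]

theorem foxD_of (k j : α) :
    foxD k (MonoidAlgebra.single (FreeGroup.of j) 1) = if j = k then 1 else 0 := by
  rw [foxD_single, one_smul, foxWord, foxRep, FreeGroup.lift_apply_of]
  simp

end Fox

/-! ### Continuous Fox derivatives of the completed group ring -/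

section ContinuousFox

variable (p : ℕ) [Fact p.Prime] (n : ℕ)

/-- The canonical homomorphism from the integral group ring of the (discrete) free group to the
completed group ring of the free pro-`p` group. -/
def toCompleted :
    MonoidAlgebra ℤ (FreeGroup (Fin n)) →+* CompletedGroupRing p (FreeProP p n) :=
  (MonoidAlgebra.lift ℤ (CompletedGroupRing p (FreeProP p n)) (FreeGroup (Fin n))
    ((CompletedGroupRing.of p (FreeProP p n)).comp
      (ProPCompletion.of p (FreeGroup (Fin n))))).toRingHom

/-- The continuous Fox derivative `∂_k` of the completed group ring of the free pro-`p` group: the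
extension by continuity of the Fox derivative `D_k` of the integral group ring of the free group,
that is, `∂_k a` is the limit of `D_k u` as `u` tends to `a`. That this limit always exists, and that
`∂_k` is continuous and extends `D_k`, is shown in `continuous_foxDeriv`, `foxDeriv_toCompleted`
(and `denseRange_toCompleted` gives uniqueness). -/
def foxDeriv (k : Fin n) (a : CompletedGroupRing p (FreeProP p n)) :
    CompletedGroupRing p (FreeProP p n) :=
  Filter.limUnder (Filter.comap (toCompleted p n) (nhds a))
    (fun u => toCompleted p n (foxD k u))

end ContinuousFox

/-! ### The Fox derivatives are continuous and extend to the completed group ring -/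

section Extension

theorem PPowNormal.finite {p : ℕ} [Fact p.Prime] {G : Type*} [Group G] (N : PPowNormal p G) :
    Finite (G ⧸ N.1) := by
  obtain ⟨k, hk⟩ := N.2.2
  have : N.1.FiniteIndex := ⟨by rw [hk]; exact pow_ne_zero _ (Fact.out : p.Prime).ne_zero⟩
  infer_instance

instance (p : ℕ) [Fact p.Prime] (G : Type*) [Group G] : CompactSpace (ProPCompletion p G) := by
  have (N : PPowNormal p G) : Finite (PQuotient p G N) := N.finite
  suffices h : IsClosed (proPCompletion p G : Set ((N : PPowNormal p G) → PQuotient p G N)) from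
    isCompact_iff_compactSpace.1 h.isCompact
  have : (proPCompletion p G : Set ((N : PPowNormal p G) → PQuotient p G N)) =
      ⋂ (M : PPowNormal p G) (N : PPowNormal p G) (h : M.1 ≤ N.1),
        {f | PQuotient.proj h (f M) = f N} := by
    ext f; simp [proPCompletion]
  rw [this]
  refine isClosed_iInter fun M => isClosed_iInter fun N => isClosed_iInter fun h => ?_
  exact isClosed_eq (continuous_of_discreteTopology.comp (continuous_apply M)) (continuous_apply N)

theorem PPowNormal.exists_le_finset {p : ℕ} [Fact p.Prime] {G : Type*} [Group G]
    (I : Finset (PPowNormal p G)) : ∃ M : PPowNormal p G, ∀ N ∈ I, M.1 ≤ N.1 := by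
  classical
  induction I using Finset.induction_on with
  | empty => exact ⟨⟨⊤, inferInstance, 0, by simp⟩, by simp⟩
  | insert N I _ ih =>
    obtain ⟨M, hM⟩ := ih
    refine ⟨⟨M.1 ⊓ N.1, inferInstance, ?_⟩, ?_⟩
    · obtain ⟨a, ha⟩ := M.2.2
      obtain ⟨b, hb⟩ := N.2.2
      have : IsPGroup p (G ⧸ (M.1 ⊓ N.1)) := by
        intro g
        induction g using QuotientGroup.induction_on with
        | H g =>
        refine ⟨a + b, ?_⟩
        rw [← QuotientGroup.mk_pow, QuotientGroup.eq_one_iff, Subgroup.mem_inf]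
        constructor
        · rw [pow_add, pow_mul]
          apply Subgroup.pow_mem
          rw [← ha]
          exact Subgroup.pow_index_mem _ _
        · rw [add_comm, pow_add, pow_mul]
          apply Subgroup.pow_mem
          rw [← hb]
          exact Subgroup.pow_index_mem _ _
      have : (M.1 ⊓ N.1).FiniteIndex := by
        have hp := (Fact.out : p.Prime).ne_zero
        have : M.1.FiniteIndex := ⟨by rw [ha]; exact pow_ne_zero _ hp⟩
        have : N.1.FiniteIndex := ⟨by rw [hb]; exact pow_ne_zero _ hp⟩
        infer_instance
      rw [Subgroup.index]
      exact IsPGroup.iff_card.1 ‹_›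
    · intro P hP
      rcases Finset.mem_insert.1 hP with rfl | h
      · exact inf_le_right
      · exact inf_le_left.trans (hM P h)

theorem ProPCompletion.exists_nhds {p : ℕ} [Fact p.Prime] {G : Type*} [Group G]
    {a : ProPCompletion p G} {W : Set (ProPCompletion p G)} (hW : W ∈ nhds a) :
    ∃ M : PPowNormal p G, ∀ b : ProPCompletion p G, b.1 M = a.1 M → b ∈ W := by
  rw [nhds_induced, Filter.mem_comap] at hW
  obtain ⟨T, hT, hTW⟩ := hW
  obtain ⟨O, hOT, hO, haO⟩ := mem_nhds_iff.1 hT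
  obtain ⟨I, u, hu, hI⟩ := isOpen_pi_iff.1 hO a.1 haO
  obtain ⟨M, hM⟩ := PPowNormal.exists_le_finset I
  refine ⟨M, fun b hb => hTW (hOT (hI ?_))⟩
  intro N hN
  rw [← b.2 M N (hM N hN), hb, a.2 M N (hM N hN)]
  exact (hu N hN).2

theorem ProPCompletion.denseRange_of (p : ℕ) [Fact p.Prime] (G : Type*) [Group G] :
    DenseRange (ProPCompletion.of p G) := by
  intro a
  rw [mem_closure_iff_nhds]
  intro W hW
  obtain ⟨M, hM⟩ := ProPCompletion.exists_nhds hW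
  obtain ⟨g, hg⟩ := QuotientGroup.mk'_surjective M.1 (a.1 M)
  exact ⟨_, hM (ProPCompletion.of p G g) hg, g, rfl⟩

theorem ProPCompletion.mk_of_surjective {p : ℕ} [Fact p.Prime] {G : Type*} [Group G]
    (V : OpenNormalSubgroup (ProPCompletion p G)) (x : ProPCompletion p G ⧸ V.toSubgroup) :
    ∃ g : G, QuotientGroup.mk' V.toSubgroup (ProPCompletion.of p G g) = x := by
  induction x using QuotientGroup.induction_on with
  | H a =>
  have ho : IsOpen {b : ProPCompletion p G | b⁻¹ * a ∈ V.toOpenSubgroup} :=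
    V.toOpenSubgroup.isOpen.preimage (by fun_prop)
  obtain ⟨g, hg⟩ := (ProPCompletion.denseRange_of p G).exists_mem_open ho ⟨a, by simp⟩
  exact ⟨g, QuotientGroup.eq.2 hg⟩

theorem ProPCompletion.exists_pow_mem {p : ℕ} [Fact p.Prime] {G : Type*} [Group G]
    (V : OpenNormalSubgroup (ProPCompletion p G)) :
    ∃ k : ℕ, ∀ g : G, ProPCompletion.of p G g ^ p ^ k ∈ V.toSubgroup := by
  have hV : (V.toOpenSubgroup : Set (ProPCompletion p G)) ∈ nhds 1 :=
    V.toOpenSubgroup.isOpen.mem_nhds (one_mem _)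
  obtain ⟨M, hM⟩ := ProPCompletion.exists_nhds hV
  obtain ⟨k, hk⟩ := M.2.2
  refine ⟨k, fun g => hM _ ?_⟩
  rw [← map_pow]
  refine (QuotientGroup.eq_one_iff _).2 ?_
  rw [← hk]
  exact Subgroup.pow_index_mem _ _

/-- The kernel of the projection of the pro-`p` completion of `G` to `G ⧸ N`. -/
def ProPCompletion.ker {p : ℕ} {G : Type*} [Group G] (N : PPowNormal p G) :
    OpenNormalSubgroup (ProPCompletion p G) where
  toSubgroup := MonoidHom.ker
    ((Pi.evalMonoidHom (PQuotient p G) N).comp (proPCompletion p G).subtype)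
  isOpen' := (isOpen_discrete {(1 : PQuotient p G N)}).preimage
    ((continuous_apply N).comp continuous_subtype_val)
  isNormal' := inferInstance

variable {p : ℕ} [Fact p.Prime] {n : ℕ}

instance (V : OpenNormalSubgroup (FreeProP p n)) : Finite (FreeProP p n ⧸ V.toSubgroup) :=
  Subgroup.quotient_finite_of_isOpen _ V.toOpenSubgroup.isOpen

/-- The image in `ℤ_p[F(n) ⧸ V]` of the integral group ring of the free group. -/
def toLevel (V : OpenNormalSubgroup (FreeProP p n)) :
    (MonoidAlgebra ℤ (FreeGroup (Fin n))) →+* MonoidAlgebra ℤ_[p] (FreeProP p n ⧸ V.toSubgroup) :=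
  ((Pi.evalRingHom _ V).comp (completedGroupRing p (FreeProP p n)).subtype).comp (toCompleted p n)

theorem toCompleted_apply (V : OpenNormalSubgroup (FreeProP p n)) (u : (MonoidAlgebra ℤ (FreeGroup (Fin n)))) :
    (toCompleted p n u).1 V = toLevel V u := rfl

theorem toLevel_single (V : OpenNormalSubgroup (FreeProP p n)) (f : FreeGroup (Fin n)) (c : ℤ) :
    toLevel V (MonoidAlgebra.single f c) =
      MonoidAlgebra.single (QuotientGroup.mk' V.toSubgroup (ProPCompletion.of p _ f)) (c : ℤ_[p]) := by
  have h1 : toLevel V (MonoidAlgebra.single f 1) =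
      MonoidAlgebra.single (QuotientGroup.mk' V.toSubgroup (ProPCompletion.of p _ f)) 1 := by
    rw [← toCompleted_apply, toCompleted]
    simp only [AlgHom.toRingHom_eq_coe, RingHom.coe_coe, MonoidAlgebra.lift_single, one_smul]
    rfl
  have : (MonoidAlgebra.single f c : (MonoidAlgebra ℤ (FreeGroup (Fin n)))) = c • MonoidAlgebra.single f 1 := by simp
  rw [this, map_zsmul, h1]
  simp

/-- Reduction of coefficients modulo `p ^ m`. -/
def redLevel (m : ℕ) (V : OpenNormalSubgroup (FreeProP p n)) :
    MonoidAlgebra ℤ_[p] (FreeProP p n ⧸ V.toSubgroup) →+*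
      MonoidAlgebra (ZMod (p ^ m)) (FreeProP p n ⧸ V.toSubgroup) :=
  MonoidAlgebra.mapRingHom _ (PadicInt.toZModPow m)

theorem redLevel_eq_zero (m : ℕ) (V : OpenNormalSubgroup (FreeProP p n))
    (a : MonoidAlgebra ℤ_[p] (FreeProP p n ⧸ V.toSubgroup)) :
    redLevel m V a = 0 ↔ ∀ x, (p : ℤ_[p]) ^ m ∣ a.coeff x := by
  have key (x) : (redLevel m V a).coeff x = PadicInt.toZModPow m (a.coeff x) := by
    simp [redLevel]
  constructor
  · intro h x
    rw [← Ideal.mem_span_singleton, ← PadicInt.ker_toZModPow, RingHom.mem_ker, ← key, h]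
    simp
  · intro h
    ext x
    have hx := h x
    rw [← Ideal.mem_span_singleton, ← PadicInt.ker_toZModPow, RingHom.mem_ker, ← key] at hx
    rw [hx]
    simp

/-- The representation `foxRep` over `(ℤ/p^m)[F(n) ⧸ V]`. -/
def foxRepLevel (m : ℕ) (V : OpenNormalSubgroup (FreeProP p n)) (k : Fin n) :
    FreeGroup (Fin n) →*
      (Matrix (Fin 2) (Fin 2) (MonoidAlgebra (ZMod (p ^ m)) (FreeProP p n ⧸ V.toSubgroup)))ˣ :=
  (Units.map (((redLevel m V).comp (toLevel V)).mapMatrix (m := Fin 2)).toMonoidHom).comp (foxRep k)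

theorem foxRepLevel_apply (m : ℕ) (V : OpenNormalSubgroup (FreeProP p n)) (k : Fin n)
    (f : FreeGroup (Fin n)) :
    (foxRepLevel m V k f : Matrix (Fin 2) (Fin 2) _) =
      !![MonoidAlgebra.single (QuotientGroup.mk' V.toSubgroup (ProPCompletion.of p _ f)) 1, 0;
        redLevel m V (toLevel V (foxWord k f)), 1] := by
  have : (foxRepLevel m V k f : Matrix (Fin 2) (Fin 2) _) =
    ((redLevel m V).comp (toLevel V)).mapMatrix (foxRep k f).1 := rfl
  rw [this, foxRep_apply]
  ext i j : 2
  fin_cases i <;> fin_cases j <;> simp [toLevel_single, redLevel]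

theorem mem_ker_foxRepLevel (m : ℕ) (V : OpenNormalSubgroup (FreeProP p n)) (k : Fin n)
    (f : FreeGroup (Fin n)) (h : ProPCompletion.of p _ f ∈ V.toSubgroup)
    (h' : redLevel m V (toLevel V (foxWord k f)) = 0) : f ∈ (foxRepLevel m V k).ker := by
  rw [MonoidHom.mem_ker, Units.ext_iff, foxRepLevel_apply, h']
  have : QuotientGroup.mk' V.toSubgroup (ProPCompletion.of p _ f) = 1 :=
    (QuotientGroup.eq_one_iff _).2 h
  rw [this, Units.val_one, Matrix.one_fin_two, MonoidAlgebra.one_def]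

theorem foxWord_pow_level (m : ℕ) (V : OpenNormalSubgroup (FreeProP p n)) (k : Fin n)
    (f : FreeGroup (Fin n)) (h : ProPCompletion.of p _ f ∈ V.toSubgroup) (i : ℕ) :
    redLevel m V (toLevel V (foxWord k (f ^ i))) =
      i • redLevel m V (toLevel V (foxWord k f)) := by
  have h1 : QuotientGroup.mk' V.toSubgroup (ProPCompletion.of p _ f) = 1 :=
    (QuotientGroup.eq_one_iff _).2 h
  induction i with
  | zero => simp [foxWord]
  | succ i ih =>
    rw [pow_succ, foxWord_mul, map_add, map_add, map_mul, map_mul, ih, toLevel_single, h1,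
      succ_nsmul]
    congr 1
    simp [redLevel, ← MonoidAlgebra.one_def]

/-- The kernel of `foxRepLevel` has `p`-power index. -/
def foxKer (m : ℕ) (V : OpenNormalSubgroup (FreeProP p n)) (k : Fin n) :
    PPowNormal p (FreeGroup (Fin n)) :=
  ⟨(foxRepLevel m V k).ker, inferInstance, by
    have : NeZero (p ^ m) := ⟨pow_ne_zero _ (Fact.out : p.Prime).ne_zero⟩
    have : Finite (MonoidAlgebra (ZMod (p ^ m)) (FreeProP p n ⧸ V.toSubgroup)) :=
      Finite.of_injective (fun a => (a.coeff : _ → ZMod (p ^ m)))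
        (fun a b h => MonoidAlgebra.coeff_injective (DFunLike.coe_injective h))
    have hfin : Finite (FreeGroup (Fin n) ⧸ (foxRepLevel m V k).ker) :=
      Finite.of_injective _ (QuotientGroup.kerLift_injective (foxRepLevel m V k))
    rw [Subgroup.index]
    refine (IsPGroup.iff_card (p := p)).1 fun g => ?_
    induction g using QuotientGroup.induction_on with
    | H g =>
    obtain ⟨a, ha⟩ := ProPCompletion.exists_pow_mem V
    refine ⟨a + m, ?_⟩
    rw [← QuotientGroup.mk_pow, QuotientGroup.eq_one_iff, pow_add, pow_mul]
    have hg : ProPCompletion.of p _ (g ^ p ^ a) ∈ V.toSubgroup := by rw [map_pow]; exact ha g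
    refine mem_ker_foxRepLevel m V k _ (by rw [map_pow]; exact pow_mem hg _) ?_
    rw [foxWord_pow_level m V k _ hg]
    rw [← Nat.cast_smul_eq_nsmul (ZMod (p ^ m)), ZMod.natCast_self, zero_smul]⟩

/-- `D_k` modulo `p ^ m` at level `V` only depends on the argument modulo `foxKer`. -/
theorem foxLevel_exists (m : ℕ) (V : OpenNormalSubgroup (FreeProP p n)) (k : Fin n) :
    ∃ d : FreeProP p n ⧸ (ProPCompletion.ker (foxKer m V k)).toSubgroup →
        MonoidAlgebra (ZMod (p ^ m)) (FreeProP p n ⧸ V.toSubgroup),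
      ∀ f, d (QuotientGroup.mk' _ (ProPCompletion.of p _ f)) =
        redLevel m V (toLevel V (foxWord k f)) := by
  choose g hg using ProPCompletion.mk_of_surjective (ProPCompletion.ker (foxKer m V k))
  have entry (f : FreeGroup (Fin n)) :
      (foxRepLevel m V k f).1 1 0 = redLevel m V (toLevel V (foxWord k f)) := by
    rw [foxRepLevel_apply]; simp
  refine ⟨fun x => redLevel m V (toLevel V (foxWord k (g x))), fun f => ?_⟩
  beta_reduce
  have h := hg (QuotientGroup.mk' _ (ProPCompletion.of p _ f))
  generalize g (QuotientGroup.mk' _ (ProPCompletion.of p _ f)) = f' at h ⊢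
  have h1 : (ProPCompletion.of p _ f')⁻¹ * ProPCompletion.of p _ f ∈
      (ProPCompletion.ker (foxKer m V k)).toSubgroup := QuotientGroup.eq.1 h
  rw [← map_inv, ← map_mul] at h1
  have h2 : f'⁻¹ * f ∈ (foxKer m V k).1 := (QuotientGroup.eq_one_iff _).1 h1
  have h3 : foxRepLevel m V k f' = foxRepLevel m V k f := ((MonoidHom.eq_iff _).2 h2).symm
  rw [← entry, ← entry, h3]

theorem foxD_level (m : ℕ) (V : OpenNormalSubgroup (FreeProP p n)) (k : Fin n) :
    ∃ U : OpenNormalSubgroup (FreeProP p n), ∀ u : MonoidAlgebra ℤ (FreeGroup (Fin n)),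
      (∀ x, (p : ℤ_[p]) ^ m ∣ (toLevel U u).coeff x) →
        ∀ y, (p : ℤ_[p]) ^ m ∣ (toLevel V (foxD k u)).coeff y := by
  obtain ⟨d, hd⟩ := foxLevel_exists m V k
  refine ⟨ProPCompletion.ker (foxKer m V k), fun u hu => ?_⟩
  rw [← redLevel_eq_zero] at hu ⊢
  let E : MonoidAlgebra (ZMod (p ^ m))
        (FreeProP p n ⧸ (ProPCompletion.ker (foxKer m V k)).toSubgroup) →+
      MonoidAlgebra (ZMod (p ^ m)) (FreeProP p n ⧸ V.toSubgroup) :=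
    (Finsupp.liftAddHom fun x => (smulAddHom (ZMod (p ^ m)) _).flip (d x)).comp
      MonoidAlgebra.coeffAddEquiv.toAddMonoidHom
  have key : ∀ u : MonoidAlgebra ℤ (FreeGroup (Fin n)), E (redLevel m _ (toLevel _ u)) = redLevel m V (toLevel V (foxD k u)) := by
    intro u
    induction u using MonoidAlgebra.induction_linear with
    | zero => simp
    | add x y hx hy => simp only [map_add, hx, hy]
    | single f c =>
      rw [toLevel_single, foxD_single, map_zsmul, map_zsmul, ← hd]
      simp [redLevel, E, Int.cast_smul_eq_zsmul, zsmul_eq_mul]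
  rw [← key, hu, map_zero]

instance instT2SpaceCGR (G : Type*) [Group G] [TopologicalSpace G] :
    T2Space (CompletedGroupRing p G) := by
  refine T2Space.of_injective_continuous (f := CompletedGroupRing.coeffs p G) ?_
    continuous_induced_dom
  intro a b h
  apply Subtype.ext
  funext U
  ext x
  exact congrFun (congrFun h U) x

theorem padic_tendsto_zero {ι : Type*} {l : Filter ι} {f : ι → ℤ_[p]}
    (h : ∀ m : ℕ, ∀ᶠ i in l, (p : ℤ_[p]) ^ m ∣ f i) : Filter.Tendsto f l (nhds 0) := by
  rw [Metric.tendsto_nhds]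
  intro ε hε
  obtain ⟨m, hm⟩ := PadicInt.exists_pow_neg_lt p hε
  filter_upwards [h m] with i hi
  rw [dist_zero_right]
  refine lt_of_le_of_lt ?_ hm
  rwa [PadicInt.norm_le_pow_iff_mem_span_pow, Ideal.mem_span_singleton]

theorem padic_eventually_dvd (m : ℕ) : ∀ᶠ x : ℤ_[p] in nhds 0, (p : ℤ_[p]) ^ m ∣ x := by
  have h0 : (0 : ℝ) < (p : ℝ) ^ (-m : ℤ) :=
    zpow_pos (by exact_mod_cast (Fact.out : p.Prime).pos) _
  filter_upwards [Metric.closedBall_mem_nhds (0 : ℤ_[p]) h0] with x hx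
  rw [Metric.mem_closedBall, dist_zero_right] at hx
  rwa [PadicInt.norm_le_pow_iff_mem_span_pow, Ideal.mem_span_singleton] at hx

theorem denseRange_toCompleted : DenseRange (toCompleted p n) := by
  intro a
  have hex (W : OpenNormalSubgroup (FreeProP p n)) (m : ℕ) :
      ∃ u : MonoidAlgebra ℤ (FreeGroup (Fin n)), ∀ x, (p : ℤ_[p]) ^ m ∣ (toLevel W u - a.1 W).coeff x := by
    choose g hg using ProPCompletion.mk_of_surjective W
    have := Fintype.ofFinite (FreeProP p n ⧸ W.toSubgroup)
    refine ⟨∑ x, MonoidAlgebra.single (g x) (((a.1 W).coeff x).appr m : ℤ), ?_⟩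
    rw [← redLevel_eq_zero, map_sub, sub_eq_zero]
    have : a.1 W = ∑ x, MonoidAlgebra.single x ((a.1 W).coeff x) := by
      classical
      ext y
      simp
    conv_rhs => rw [this]
    simp only [map_sum, toLevel_single, hg]
    refine Finset.sum_congr rfl fun x _ => ?_
    simp only [redLevel, MonoidAlgebra.mapRingHom_single]
    congr 1
    have h := PadicInt.appr_spec m ((a.1 W).coeff x)
    rw [← PadicInt.ker_toZModPow, RingHom.mem_ker, map_sub, sub_eq_zero] at h
    rw [h]
    simp
  choose u hu using hex
  let l : Filter (OpenNormalSubgroup (FreeProP p n) × ℕ) := Filter.atBot ×ˢ Filter.atTop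
  have : Nonempty (OpenNormalSubgroup (FreeProP p n)) :=
    ⟨{ toOpenSubgroup := ⊤, isNormal' := inferInstanceAs (⊤ : Subgroup _).Normal }⟩
  have ht : Filter.Tendsto (fun i => toCompleted p n (u i.1 i.2)) l (nhds a) := by
    rw [nhds_induced, Filter.tendsto_comap_iff, tendsto_pi_nhds]
    intro U
    rw [tendsto_pi_nhds]
    intro x
    rw [← tendsto_sub_nhds_zero_iff]
    refine padic_tendsto_zero fun m => ?_
    filter_upwards [(Filter.eventually_le_atBot U).prod_mk (Filter.eventually_ge_atTop m)]
      with i hi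
    have hle : i.1.toSubgroup ≤ U.toSubgroup := hi.1
    have h1 : redLevel i.2 U ((toCompleted p n (u i.1 i.2)).1 U - a.1 U) = 0 := by
      have h2 := (redLevel_eq_zero i.2 i.1 _).2 (hu i.1 i.2)
      rw [← (toCompleted p n (u i.1 i.2)).2 i.1 U hle, ← a.2 i.1 U hle, ← map_sub,
        toCompleted_apply]
      have hc : (redLevel i.2 U).comp (MonoidAlgebra.mapDomainRingHom ℤ_[p] (quotProj hle)) =
          (MonoidAlgebra.mapDomainRingHom (ZMod (p ^ i.2)) (quotProj hle)).comp
            (redLevel i.2 i.1) := by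
        ext <;> simp [redLevel]
      rw [← RingHom.comp_apply, hc, RingHom.comp_apply, h2, map_zero]
    exact (pow_dvd_pow _ hi.2).trans ((redLevel_eq_zero i.2 U _).1 h1 x)
  exact mem_closure_of_tendsto ht (Filter.Eventually.of_forall fun i => ⟨_, rfl⟩)

theorem isClosed_range_coeffs : IsClosed (Set.range (CompletedGroupRing.coeffs p (FreeProP p n))) := by
  classical
  have (U : OpenNormalSubgroup (FreeProP p n)) := Fintype.ofFinite (FreeProP p n ⧸ U.toSubgroup)
  have : Set.range (CompletedGroupRing.coeffs p (FreeProP p n)) =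
      ⋂ (U : OpenNormalSubgroup (FreeProP p n)) (V : OpenNormalSubgroup (FreeProP p n))
        (h : U.toSubgroup ≤ V.toSubgroup) (y : FreeProP p n ⧸ V.toSubgroup),
        {φ | (∑ x, if quotProj h x = y then φ U x else 0) = φ V y} := by
    have hsum (U V : OpenNormalSubgroup (FreeProP p n)) (h : U.toSubgroup ≤ V.toSubgroup)
        (a : MonoidAlgebra ℤ_[p] (FreeProP p n ⧸ U.toSubgroup)) (y) :
        (MonoidAlgebra.mapDomainRingHom ℤ_[p] (quotProj h) a).coeff y =
          ∑ x, if quotProj h x = y then a.coeff x else 0 := by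
      induction a using MonoidAlgebra.induction_linear with
      | zero => simp
      | add a b ha hb =>
        rw [map_add, MonoidAlgebra.coeff_add, Finsupp.add_apply, ha, hb, ← Finset.sum_add_distrib]
        refine Finset.sum_congr rfl fun x _ => ?_
        split_ifs <;> simp
      | single g c =>
        rw [Finset.sum_eq_single g]
        · simp [Finsupp.single_apply]
        · intro b _ hb
          simp [hb.symm]
        · simp
    ext φ
    simp only [Set.mem_range, Set.mem_iInter, Set.mem_ofPred_eq]
    constructor
    · rintro ⟨a, rfl⟩ U V h y
      rw [CompletedGroupRing.coeffs, ← a.2 U V h, hsum]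
      rfl
    · intro hφ
      refine ⟨⟨fun U => MonoidAlgebra.ofCoeff (Finsupp.equivFunOnFinite.symm (φ U)), ?_⟩, ?_⟩
      · intro U V h
        ext y
        rw [hsum]
        exact hφ U V h y
      · rfl
  rw [this]
  refine isClosed_iInter fun U => isClosed_iInter fun V => isClosed_iInter fun h =>
    isClosed_iInter fun y => isClosed_eq ?_ ?_
  · refine continuous_finsetSum _ fun x _ => ?_
    split_ifs
    · exact (continuous_apply x).comp (continuous_apply U)
    · exact continuous_const
  · exact (continuous_apply y).comp (continuous_apply V)

/-- The coefficients as an additive homomorphism. -/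
def coeffsHom : CompletedGroupRing p (FreeProP p n) →+
    ((U : OpenNormalSubgroup (FreeProP p n)) → FreeProP p n ⧸ U.toSubgroup → ℤ_[p]) where
  toFun := CompletedGroupRing.coeffs p (FreeProP p n)
  map_zero' := rfl
  map_add' _ _ := rfl

theorem foxDeriv_aux (k : Fin n) : Continuous (foxDeriv p n k) ∧
    ∀ u : MonoidAlgebra ℤ (FreeGroup (Fin n)), foxDeriv p n k (toCompleted p n u) = toCompleted p n (foxD k u) := by
  let _ : UniformSpace (CompletedGroupRing p (FreeProP p n)) :=
    UniformSpace.comap (coeffsHom (p := p) (n := n)) inferInstance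
  have h1 : IsUniformAddGroup (CompletedGroupRing p (FreeProP p n)) :=
    IsUniformAddGroup.comap coeffsHom
  have hind : IsUniformInducing (coeffsHom (p := p) (n := n)) := ⟨rfl⟩
  have h2 : CompleteSpace (CompletedGroupRing p (FreeProP p n)) := by
    rw [completeSpace_iff_isComplete_range hind]
    exact isClosed_range_coeffs.isComplete
  have h4 : @T0Space (CompletedGroupRing p (FreeProP p n)) UniformSpace.toTopologicalSpace :=
    @T1Space.t0Space _ _ (@T2Space.t1Space _ _ (instT2SpaceCGR _))
  let _ : UniformSpace (MonoidAlgebra ℤ (FreeGroup (Fin n))) := UniformSpace.comap (toCompleted p n) inferInstance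
  have h3 : IsUniformAddGroup (MonoidAlgebra ℤ (FreeGroup (Fin n))) := IsUniformAddGroup.comap (toCompleted p n)
  have hi : IsUniformInducing (toCompleted p n) := ⟨rfl⟩
  let D : (MonoidAlgebra ℤ (FreeGroup (Fin n))) →+ CompletedGroupRing p (FreeProP p n) :=
    (toCompleted p n).toAddMonoidHom.comp (foxD k)
  have hD : UniformContinuous D := by
    refine uniformContinuous_of_continuousAt_zero D ?_
    rw [ContinuousAt, map_zero, hind.isInducing.nhds_eq_comap, Filter.tendsto_comap_iff,
      map_zero, tendsto_pi_nhds]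
    intro V
    rw [tendsto_pi_nhds]
    intro y
    refine padic_tendsto_zero fun m => ?_
    obtain ⟨U, hU⟩ := foxD_level m V k
    have hc (x : FreeProP p n ⧸ U.toSubgroup) :
        Filter.Tendsto (fun u : (MonoidAlgebra ℤ (FreeGroup (Fin n))) => coeffsHom (toCompleted p n u) U x) (nhds 0) (nhds 0) := by
      have : Continuous (fun u : (MonoidAlgebra ℤ (FreeGroup (Fin n))) => coeffsHom (toCompleted p n u) U x) :=
        (continuous_apply x).comp ((continuous_apply U).comp
          (hind.isInducing.continuous.comp hi.isInducing.continuous))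
      have h := this.tendsto 0
      simpa using h
    filter_upwards [Filter.eventually_all.2 fun x => (hc x).eventually (padic_eventually_dvd m)]
      with u hu
    exact hU u hu y
  have hfun : foxDeriv p n k =
      (hi.isDenseInducing denseRange_toCompleted).extend D := rfl
  rw [hfun]
  exact ⟨(uniformContinuous_uniformly_extend hi denseRange_toCompleted hD).continuous,
    fun u => uniformly_extend_of_ind hi denseRange_toCompleted hD u⟩

/-- `∂_k` is continuous. -/
theorem continuous_foxDeriv (k : Fin n) : Continuous (foxDeriv p n k) := (foxDeriv_aux k).1

/-- `∂_k` extends `D_k`. -/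
theorem foxDeriv_toCompleted (k : Fin n) (u : (MonoidAlgebra ℤ (FreeGroup (Fin n)))) :
    foxDeriv p n k (toCompleted p n u) = toCompleted p n (foxD k u) := (foxDeriv_aux k).2 u

end Extension

end

/-! Write H for `FreeProP.sub p n K` and L₀ for the normal subgroup generated by H ∩ N and [N, N].
It suffices to find, for every open normal subgroup W, an element of H L₀ in the coset vW.
Everything then takes place modulo L = L₀W, with N replaced by an open normal subgroup U ⊇ N close
enough to N that H ∩ U and [U, U] still lie in L (`exists_openNormal_inf_le`, `commutator_sup_le`).
Moreover u ^ q ∈ W for a suitable power q of p, and v may be replaced by a congruent element f of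
the discrete free group whose Fox derivatives outside K vanish over (ℤ/q)[F(n)/U]
(`exists_of_approx`).

The algebraic core, `mem_mul_of_dvd_foxWord`, shows f ∈ HL. By Fox's formula a crossed homomorphism
c is determined by its values at the generators: c(f) is the sum over k of c(x_k) acted on by
D_k(f). So c(f) = 0 if q kills the module and c(x_k) = 0 for all k ∈ K (`crossedHom_eq_zero`). This
is applied twice to modules of functions on F(n)/U. The coboundary of the indicator function of HU/U
gives f ∈ HU. The Kaloujnine–Krasner cocycle s(x g⁻¹) g s(x)⁻¹ with values in U/(U ∩ L), for a
section s compatible with H, then improves this to f ∈ HL. -/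

/-! ### Crossed homomorphisms and Fox derivatives over a quotient group -/

/-- A crossed homomorphism on a free group vanishes at `f` if it vanishes at the generators `x_k`,
`k ∈ K`, and is annihilated by the Fox derivatives of `f` with respect to the other generators. -/
theorem crossedHom_eq_zero {n : ℕ} {Q M : Type*} [Group Q] [AddCommGroup M] (q : ℕ)
    (hq : ∀ m : M, q • m = 0) (θ : FreeGroup (Fin n) →* Q) (c : FreeGroup (Fin n) → Q → M)
    (hc : ∀ u v x, c (u * v) x = c u (x * (θ v)⁻¹) + c v x) (K : Set (Fin n))
    (hK : ∀ k ∈ K, c (FreeGroup.of k) = 0) (f : FreeGroup (Fin n))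
    (hf : ∀ k ∉ K, ∀ y : Q, (q : ℤ) ∣ (MonoidAlgebra.mapDomainRingHom ℤ θ (foxWord k f)).coeff y) :
    c f = 0 := by
  -- The right action (φ · y)(x) = φ(x y⁻¹) of Q on functions, extended additively to ℤ[Q] and
  -- evaluated at x.
  let E (φ : Q → M) (x : Q) : MonoidAlgebra ℤ Q →+ M :=
    (Finsupp.liftAddHom fun y => zmultiplesHom M (φ (x * y⁻¹))).comp
      MonoidAlgebra.coeffAddEquiv.toAddMonoidHom
  have hE (φ : Q → M) (x y : Q) (a : ℤ) : E φ x (MonoidAlgebra.single y a) = a • φ (x * y⁻¹) := by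
    simp [E]
  have hEmul (φ : Q → M) (x y : Q) (a : MonoidAlgebra ℤ Q) :
      E φ x (a * MonoidAlgebra.single y 1) = E φ (x * y⁻¹) a := by
    induction a using MonoidAlgebra.induction_linear with
    | zero => simp
    | add a b ha hb => rw [add_mul, map_add, map_add, ha, hb]
    | single z a => rw [MonoidAlgebra.single_mul_single, hE, hE]; simp [mul_assoc]
  have h1 (x : Q) : c 1 x = 0 := by
    have := hc 1 1 x
    simpa using this
  have hword (k : Fin n) : foxWord k (1 : FreeGroup (Fin n)) = 0 := by simp [foxWord]
  have hθ (g : FreeGroup (Fin n)) : MonoidAlgebra.mapDomainRingHom ℤ θ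
      (MonoidAlgebra.single g 1) = MonoidAlgebra.single (θ g) 1 := by simp
  -- Fox's formula: both sides satisfy the same product rule and agree at the generators.
  have key (g : FreeGroup (Fin n)) : ∀ x, c g x = ∑ k, E (c (FreeGroup.of k)) x
      (MonoidAlgebra.mapDomainRingHom ℤ θ (foxWord k g)) := by
    induction g using FreeGroup.induction_on with
    | C1 => simp [h1, hword]
    | of j =>
      intro x
      have h (k : Fin n) : foxWord k (FreeGroup.of j) = if j = k then 1 else 0 := by
        rw [← foxD_of, foxD_single, one_smul]
      rw [Finset.sum_eq_single j]
      · rw [h, if_pos rfl, map_one, MonoidAlgebra.one_def, hE]; simp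
      · intro k _ hk
        rw [h, if_neg hk.symm, map_zero, map_zero]
      · simp
    | inv_of j ih =>
      intro x
      have h (k : Fin n) := foxWord_mul k (FreeGroup.of j) (FreeGroup.of j)⁻¹
      simp only [mul_inv_cancel, hword] at h
      have h2 := hc (FreeGroup.of j) (FreeGroup.of j)⁻¹ x
      rw [mul_inv_cancel, h1] at h2
      rw [eq_neg_of_add_eq_zero_right h2.symm, ih, ← Finset.sum_neg_distrib]
      refine Finset.sum_congr rfl fun k _ => ?_
      rw [eq_neg_of_add_eq_zero_right (h k).symm, map_neg, map_neg, map_mul, hθ, hEmul]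
    | mul u v hu hv =>
      intro x
      rw [hc, hu, hv, ← Finset.sum_add_distrib]
      refine Finset.sum_congr rfl fun k _ => ?_
      rw [foxWord_mul, map_add, map_add, map_mul, hθ, hEmul]
  funext x
  rw [key, Pi.zero_apply]
  refine Finset.sum_eq_zero fun k _ => ?_
  have hval (a : MonoidAlgebra ℤ Q) : E (c (FreeGroup.of k)) x a =
      a.coeff.sum fun y m => m • c (FreeGroup.of k) (x * y⁻¹) := rfl
  rw [hval]
  -- For k ∈ K the value at x_k is zero; otherwise every coefficient is a multiple of q, which
  -- annihilates M.
  by_cases hk : k ∈ K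
  · simp [hK k hk]
  · refine Finset.sum_eq_zero fun y _ => ?_
    obtain ⟨b, hb⟩ := hf k hk y
    beta_reduce
    rw [hb, mul_comm, mul_smul, natCast_zsmul, hq, smul_zero]

/-- For `H ⊓ U ≤ L`, the quotient map by `U` has a section which is `H`-equivariant modulo `L`. -/
theorem exists_equivariant_section {P : Type*} [Group P] (H U L : Subgroup P) [U.Normal]
    (hHU : H ⊓ U ≤ L) : ∃ s : P ⧸ U → P, (∀ x, (s x : P ⧸ U) = x) ∧
      ∀ x, ∀ h ∈ H, (s x * h)⁻¹ * s (x * (h : P ⧸ U)) ∈ L := by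
  -- One base point is fixed in each left coset of H ⊔ U, and x is lifted to the base point of its
  -- coset times an element of H.
  have hex (x : P ⧸ U) : ∃ h ∈ H, ((Quotient.out (QuotientGroup.mk
      (Quotient.out x) : P ⧸ (H ⊔ U)) * h : P) : P ⧸ U) = x := by
    have h1 : (Quotient.out (QuotientGroup.mk (Quotient.out x) : P ⧸ (H ⊔ U)))⁻¹ *
        Quotient.out x ∈ H ⊔ U := QuotientGroup.eq.1 (QuotientGroup.out_eq' _)
    obtain ⟨h, hh, u, hu, e⟩ := Subgroup.mem_sup_of_normal_right.1 h1
    refine ⟨h, hh, ?_⟩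
    conv_rhs => rw [← QuotientGroup.out_eq' x]
    rw [QuotientGroup.eq, mul_inv_rev, mul_assoc, ← e, inv_mul_cancel_left]
    exact hu
  choose r hr hrx using hex
  refine ⟨_, hrx, fun x h hh => ?_⟩
  -- Right multiplication by h preserves the coset of H ⊔ U, so both lifts use the same base point
  -- and s(x) h differs from s(xh) by an element of H. Both lie above xh, so the difference is also
  -- in U.
  have hx : (QuotientGroup.mk (Quotient.out (x * (h : P ⧸ U))) : P ⧸ (H ⊔ U)) =
      QuotientGroup.mk (Quotient.out x) := by
    refine (QuotientGroup.eq.2 ?_).symm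
    have : h⁻¹ * ((Quotient.out x)⁻¹ * Quotient.out (x * (h : P ⧸ U))) ∈ U := by
      rw [← QuotientGroup.eq_one_iff]
      simp
    exact ((H ⊔ U).mul_mem_cancel_left (inv_mem (Subgroup.mem_sup_left hh))).1
      (Subgroup.mem_sup_right this)
  have hU : ((r x * h)⁻¹ * r (x * (h : P ⧸ U)) : P) ∈ U := by
    have h1 := hrx x
    have h2 := hrx (x * (h : P ⧸ U))
    rw [hx] at h2
    conv_rhs at h2 => rw [← h1]
    rw [← QuotientGroup.mk_mul, mul_assoc, eq_comm, QuotientGroup.eq] at h2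
    simpa [mul_assoc] using h2
  rw [hx]
  have := hHU ⟨H.mul_mem (H.inv_mem (H.mul_mem (hr x) hh)) (hr _), hU⟩
  simpa [mul_assoc] using this

/-- A Kaloujnine–Krasner type argument: an element of a free group whose Fox derivatives outside of
`K` vanish modulo `U` and `q` lies in `H * L`. -/
theorem mem_mul_of_dvd_foxWord {n : ℕ} {P : Type*} [Group P] (ι : FreeGroup (Fin n) →* P)
    (H U L : Subgroup P) [U.Normal] [L.Normal] (q : ℕ) (hq : q ≠ 1) (hHU : H ⊓ U ≤ L)
    (hUU : ⁅U, U⁆ ≤ L) (hUq : ∀ u ∈ U, u ^ q ∈ L) (K : Set (Fin n))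
    (hK : ∀ k ∈ K, ι (FreeGroup.of k) ∈ H) (f : FreeGroup (Fin n))
    (hf : ∀ k ∉ K, ∀ y : P ⧸ U, (q : ℤ) ∣ (MonoidAlgebra.mapDomainRingHom ℤ
      ((QuotientGroup.mk' U).comp ι) (foxWord k f)).coeff y) :
    ∃ h ∈ H, ι f * h⁻¹ ∈ L := by
  classical
  set θ := (QuotientGroup.mk' U).comp ι
  have hθapp (g) : θ g = (ι g : P ⧸ U) := rfl
  obtain ⟨h, hh, hfh⟩ : ∃ h ∈ H, (h : P ⧸ U) = ι f := by
    -- The indicator function of A is invariant under right translation by A, so its coboundary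
    -- vanishes at x_k for k ∈ K. Its vanishing at f, evaluated at 1, says that θ f ∈ A; q ≠ 1 is
    -- needed for 1 ≠ 0 in ℤ/q.
    let A := H.map (QuotientGroup.mk' U)
    let φ (x : P ⧸ U) : ZMod q := if x ∈ A then 1 else 0
    have h0 := crossedHom_eq_zero (M := ZMod q) q (fun m => by simp) θ
      (fun g x => φ (x * (θ g)⁻¹) - φ x) (fun u v x => by simp [mul_assoc]) K
      (fun k hk => by
        funext x
        have : θ (FreeGroup.of k) ∈ A := ⟨_, hK k hk, rfl⟩
        simp [φ, A.mul_mem_cancel_right (A.inv_mem this)]) f hf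
    have h1 := congrFun h0 1
    have hnt : Nontrivial (ZMod q) := ZMod.nontrivial_iff.2 hq
    have h2 : θ f ∈ A := by
      by_contra hcon
      simp [φ, A.one_mem, hcon] at h1
    obtain ⟨h, hh, e⟩ := h2
    exact ⟨h, hh, e⟩
  obtain ⟨s, hs, hsH⟩ := exists_equivariant_section H U L hHU
  -- These are the values of the Kaloujnine–Krasner cocycle; by equivariance of s they fall into L
  -- when g ∈ H.
  have hmem (g : P) (x : P ⧸ U) : s (x * (g : P ⧸ U)⁻¹) * g * (s x)⁻¹ ∈ U := by
    rw [← QuotientGroup.eq_one_iff]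
    simp [hs]
  have hH (h : P) (hh : h ∈ H) (x : P ⧸ U) : s (x * (h : P ⧸ U)⁻¹) * h * (s x)⁻¹ ∈ L := by
    have := hsH (x * (h : P ⧸ U)⁻¹) h hh
    rw [inv_mul_cancel_right] at this
    rw [← inv_mem_iff, mul_inv_rev, inv_inv]
    exact (Subgroup.Normal.mem_comm_iff inferInstance).1 this
  let B := U ⧸ L.subgroupOf U
  let _ : CommGroup B :=
    { (inferInstance : Group B) with
      mul_comm := by
        intro a b
        induction a using QuotientGroup.induction_on with
        | H a =>
        induction b using QuotientGroup.induction_on with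
        | H b =>
        refine QuotientGroup.eq.2 ?_
        rw [Subgroup.mem_subgroupOf]
        have := hUU (Subgroup.commutator_mem_commutator (U.inv_mem b.2) (U.inv_mem a.2))
        simpa [commutatorElement_def, mul_assoc] using this }
  let c (g : FreeGroup (Fin n)) (x : P ⧸ U) : Additive B :=
    Additive.ofMul (QuotientGroup.mk (⟨_, hmem (ι g) x⟩ : U))
  have hc1 (g : FreeGroup (Fin n)) (x : P ⧸ U) :
      c g x = 0 ↔ s (x * (ι g : P ⧸ U)⁻¹) * ι g * (s x)⁻¹ ∈ L := by
    rw [← Subgroup.mem_subgroupOf (h := ⟨_, hmem (ι g) x⟩) (H := L) (K := U)]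
    exact QuotientGroup.eq_one_iff _
  have h0 := crossedHom_eq_zero (M := Additive B) q
    (fun m => by
      induction m using Additive.rec with
      | ofMul m =>
      induction m using QuotientGroup.induction_on with
      | H m => exact (QuotientGroup.eq_one_iff _).2 (hUq m m.2)) θ c
    -- The product telescopes: the factors s(x v⁻¹)⁻¹ and s(x v⁻¹) cancel.
    (fun u v x => by
      refine congrArg (fun y : U => Additive.ofMul (y : B)) (Subtype.ext ?_)
      simp [hθapp, mul_assoc]) K
    (fun k hk => by
      funext x
      exact (hc1 _ _).2 (hH _ (hK k hk) x)) f hf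
  -- Since ι f and h agree modulo U, both cocycle values at 1 begin with the same s(·) and end with
  -- s(1)⁻¹. Their quotient is a conjugate of ι f * h⁻¹.
  have h1 := (hc1 f 1).1 (congrFun h0 1)
  have h2 := hH h hh 1
  rw [hfh] at h2
  refine ⟨h, hh, ?_⟩
  have h3 := L.mul_mem h1 (L.inv_mem h2)
  have h4 := Subgroup.Normal.conj_mem ‹L.Normal› _ h3 (s (1 * (ι f : P ⧸ U)⁻¹))⁻¹
  simpa [mul_assoc] using h4

/-! ### Passing from the completed group ring to finite levels -/

section CompletedGroupRing

variable {p : ℕ} [Fact p.Prime]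

theorem CompletedGroupRing.continuous_of (G : Type*) [Group G] [TopologicalSpace G]
    [IsTopologicalGroup G] : Continuous (CompletedGroupRing.of p G) := by
  rw [continuous_induced_rng]
  refine continuous_pi fun U => ?_
  have : DiscreteTopology (G ⧸ U.toSubgroup) :=
    QuotientGroup.discreteTopology U.toOpenSubgroup.isOpen
  exact (continuous_of_discreteTopology (f := fun x y =>
    (MonoidAlgebra.single x (1 : ℤ_[p]) : MonoidAlgebra ℤ_[p] (G ⧸ U.toSubgroup)).coeff y)).comp
      continuous_quotient_mk'

/-- An element killed by `ℤ_p[[G]] → ℤ_p[[G ⧸ N]]` has trivial components at the open normal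
subgroups that contain `N`. -/
theorem CompletedGroupRing.apply_preimage_eq_zero {G : Type*} [Group G] [TopologicalSpace G]
    (N : Subgroup G) [N.Normal] {a : CompletedGroupRing p G}
    (ha : CompletedGroupRing.quotientMap p N a = 0) (V : OpenNormalSubgroup (G ⧸ N)) :
    a.1 (V.preimage (QuotientGroup.mk' N) continuous_quotient_mk') = 0 := by
  have h : MonoidAlgebra.mapDomainRingHom ℤ_[p] (QuotientGroup.map
      (V.preimage (QuotientGroup.mk' N) continuous_quotient_mk').toSubgroup V.toSubgroup
      (QuotientGroup.mk' N) le_rfl)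
      (a.1 (V.preimage (QuotientGroup.mk' N) continuous_quotient_mk')) = 0 :=
    congrFun (congrArg Subtype.val ha) V
  -- Third isomorphism theorem: passing to G ⧸ N loses nothing at a level whose subgroup is a full
  -- preimage.
  have hinj : Function.Injective (QuotientGroup.map
      (V.preimage (QuotientGroup.mk' N) continuous_quotient_mk').toSubgroup V.toSubgroup
      (QuotientGroup.mk' N) le_rfl) := by
    rw [injective_iff_map_eq_one]
    intro x hx
    induction x using QuotientGroup.induction_on with
    | H g => exact (QuotientGroup.eq_one_iff _).2 ((QuotientGroup.eq_one_iff (QuotientGroup.mk g : G ⧸ N)).1 hx)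
  exact MonoidAlgebra.mapDomain_injective hinj (h.trans (map_zero
    (MonoidAlgebra.mapDomainRingHom ℤ_[p] _)).symm)

variable {n : ℕ}

theorem foxDeriv_of (k : Fin n) (f : FreeGroup (Fin n)) :
    foxDeriv p n k (CompletedGroupRing.of p _ (ProPCompletion.of p _ f)) =
      toCompleted p n (foxWord k f) := by
  have h : CompletedGroupRing.of p _ (ProPCompletion.of p _ f) =
      toCompleted p n (MonoidAlgebra.single f 1) := by
    simp [toCompleted]
  rw [h, foxDeriv_toCompleted, foxD_single, one_smul]

/-- Coefficients coming from the discrete free group are integers, so divisibility by p ^ m in ℤ_p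
descends to divisibility in ℤ, as `mem_mul_of_dvd_foxWord` requires. -/
theorem toLevel_coeff (V : OpenNormalSubgroup (FreeProP p n))
    (u : MonoidAlgebra ℤ (FreeGroup (Fin n))) (y : FreeProP p n ⧸ V.toSubgroup) :
    (toLevel V u).coeff y = ((MonoidAlgebra.mapDomainRingHom ℤ
      ((QuotientGroup.mk' V.toSubgroup).comp (ProPCompletion.of p _)) u).coeff y : ℤ) := by
  classical
  induction u using MonoidAlgebra.induction_linear with
  | zero => simp
  | add a b ha hb => simp only [map_add, MonoidAlgebra.coeff_add, Finsupp.add_apply, ha, hb,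
      Int.cast_add]
  | single f c =>
    rw [toLevel_single]
    simp [Finsupp.single_apply]

/-- Elements of the free group close to `v` whose Fox derivatives approximate those of `v`. -/
theorem exists_of_approx (v : FreeProP p n) (W V : OpenNormalSubgroup (FreeProP p n)) (m : ℕ) :
    ∃ f : FreeGroup (Fin n), (ProPCompletion.of p _ f)⁻¹ * v ∈ W.toSubgroup ∧ ∀ k,
      (foxDeriv p n k (CompletedGroupRing.of p _ v)).1 V = 0 →
        ∀ y, (p : ℤ) ^ m ∣ (MonoidAlgebra.mapDomainRingHom ℤ
          ((QuotientGroup.mk' V.toSubgroup).comp (ProPCompletion.of p _)) (foxWord k f)).coeff y := by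
  have h1 : ∀ᶠ g in nhds v, g⁻¹ * v ∈ W.toSubgroup :=
    (W.toOpenSubgroup.isOpen.preimage (f := fun g => g⁻¹ * v) (by fun_prop)).mem_nhds
      (by simp)
  -- There are finitely many k and, as F(n)/V is finite, finitely many y. Each condition holds near
  -- v by continuity of ∂_k, because multiples of p ^ m form a neighbourhood of 0 in ℤ_p.
  have h2 : ∀ᶠ g in nhds v, ∀ k, ∀ y, (foxDeriv p n k (CompletedGroupRing.of p _ v)).1 V = 0 →
      (p : ℤ_[p]) ^ m ∣ ((foxDeriv p n k (CompletedGroupRing.of p _ g)).1 V).coeff y := by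
    rw [Filter.eventually_all]
    intro k
    rw [Filter.eventually_all]
    intro y
    rw [Filter.eventually_imp_distrib_left]
    intro h0
    have hc : Continuous fun g =>
        ((foxDeriv p n k (CompletedGroupRing.of p _ g)).1 V).coeff y :=
      (continuous_apply y).comp ((continuous_apply V).comp (continuous_induced_dom.comp
        ((continuous_foxDeriv k).comp (CompletedGroupRing.continuous_of _))))
    have := hc.tendsto v
    beta_reduce at this
    rw [h0] at this
    exact this.eventually (padic_eventually_dvd m)
  obtain ⟨O, hO, hOo, hvO⟩ := mem_nhds_iff.1 (h1.and h2)
  obtain ⟨f, hf⟩ := (ProPCompletion.denseRange_of p (FreeGroup (Fin n))).exists_mem_open hOo ⟨v, hvO⟩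
  obtain ⟨hf1, hf2⟩ := hO hf
  refine ⟨f, hf1, fun k hk y => ?_⟩
  have h := hf2 k y hk
  rw [foxDeriv_of, toCompleted_apply, toLevel_coeff] at h
  exact (PadicInt.pow_p_dvd_int_iff _ _).1 h

end CompletedGroupRing

/-! ### Approximating a closed normal subgroup by open ones -/

/-- In a profinite group, the intersections of a closed subgroup `H` with the open normal subgroups
containing `N` shrink to `H ⊓ N`. -/
theorem exists_openNormal_inf_le {G : Type*} [Group G] [TopologicalSpace G]
    [IsTopologicalGroup G] [CompactSpace G] [TotallyDisconnectedSpace G]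
    (H N : Subgroup G) [N.Normal] (hH : IsClosed (H : Set G)) (hN : IsClosed (N : Set G))
    (W : OpenNormalSubgroup G) : ∃ V : OpenNormalSubgroup (G ⧸ N),
      (V.preimage (QuotientGroup.mk' N) continuous_quotient_mk').toSubgroup ≤ N ⊔ W.toSubgroup ∧
      H ⊓ (V.preimage (QuotientGroup.mk' N) continuous_quotient_mk').toSubgroup ≤
        (H ⊓ N) ⊔ W.toSubgroup := by
  have hW : IsOpen (((H ⊓ N) ⊔ W.toSubgroup : Subgroup G) : Set G) :=
    Subgroup.isOpen_mono le_sup_right W.toOpenSubgroup.isOpen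
  -- C is the part of H to be avoided. It is compact, so N * C is closed, and 1 ∉ N * C because an
  -- element of C inverse to an element of N would lie in H ⊓ N.
  let C : Set G := H ∩ (((H ⊓ N) ⊔ W.toSubgroup : Subgroup G) : Set G)ᶜ
  have hC : IsCompact C := (hH.inter hW.isClosed_compl).isCompact
  have hNC : IsClosed ((N : Set G) * C) := hN.mul_right_of_isCompact hC
  have hone : (1 : G) ∈ ((N : Set G) * C)ᶜ := by
    rintro ⟨x, hx, y, ⟨hy, hy'⟩, e⟩
    refine hy' (Subgroup.mem_sup_left ⟨hy, ?_⟩)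
    rw [← inv_mul_cancel_left x y, show x * y = 1 from e, mul_one]
    exact N.inv_mem hx
  obtain ⟨V, hV⟩ := ProfiniteGrp.exist_openNormalSubgroup_sub_open_nhds_of_one
    hNC.isOpen_compl hone
  have hnorm : (((V ⊓ W : OpenNormalSubgroup G).toSubgroup).map (QuotientGroup.mk' N)).Normal :=
    Subgroup.Normal.map inferInstance _ (QuotientGroup.mk'_surjective N)
  have hpre : (((V ⊓ W : OpenNormalSubgroup G).toSubgroup).map (QuotientGroup.mk' N)).comap
      (QuotientGroup.mk' N) = (V ⊓ W : OpenNormalSubgroup G).toSubgroup ⊔ N := by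
    rw [Subgroup.comap_map_eq, QuotientGroup.ker_mk']
  -- The preimage of this image is N(V ⊓ W): the factor W gives the first inclusion, and V, being
  -- disjoint from N * C, gives the second.
  refine ⟨{ toSubgroup := ((V ⊓ W : OpenNormalSubgroup G).toSubgroup).map (QuotientGroup.mk' N)
            isOpen' := QuotientGroup.isOpenMap_coe _ (V ⊓ W).toOpenSubgroup.isOpen
            isNormal' := hnorm }, hpre.le.trans (sup_le ?_ le_sup_left), ?_⟩
  · exact le_trans (fun x hx => hx.2) le_sup_right
  · rintro g ⟨hg, hg'⟩
    by_contra hcon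
    have hgU : g ∈ N ⊔ (V ⊓ W : OpenNormalSubgroup G).toSubgroup := by
      rw [sup_comm]; exact hpre.le hg'
    obtain ⟨x, hx, y, hy, e⟩ := Subgroup.mem_sup_of_normal_right.1 hgU
    refine hV (show y ∈ V from hy.1) ⟨x⁻¹, N.inv_mem hx, g, ⟨hg, hcon⟩, ?_⟩
    exact inv_mul_eq_of_eq_mul e.symm

open scoped commutatorElement in
-- Modulo the normal subgroup W, the commutator of xw and yz is that of x and y.
theorem commutator_sup_le {G : Type*} [Group G] (N W : Subgroup G) [W.Normal] :
    ⁅N ⊔ W, N ⊔ W⁆ ≤ ⁅N, N⁆ ⊔ W := by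
  rw [Subgroup.commutator_le]
  intro a ha b hb
  obtain ⟨x, hx, w, hw, rfl⟩ := Subgroup.mem_sup_of_normal_right.1 ha
  obtain ⟨y, hy, z, hz, rfl⟩ := Subgroup.mem_sup_of_normal_right.1 hb
  have h1 : (⁅x, y⁆)⁻¹ * ⁅x * w, y * z⁆ ∈ W := by
    have hw' : (w : G ⧸ W) = 1 := (QuotientGroup.eq_one_iff _).2 hw
    have hz' : (z : G ⧸ W) = 1 := (QuotientGroup.eq_one_iff _).2 hz
    rw [← QuotientGroup.eq_one_iff]
    simp [commutatorElement_def, hw', hz', mul_assoc]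
  have := (⁅N, N⁆ ⊔ W).mul_mem (Subgroup.mem_sup_left (Subgroup.commutator_mem_commutator hx hy))
    (Subgroup.mem_sup_right h1)
  rwa [mul_inv_cancel_left] at this

/-! ### The approximation argument for the main theorem -/

theorem theorem1 (p : ℕ) [Fact p.Prime] (n : ℕ) (K : Set (Fin n))
    (N : Subgroup (FreeProP p n)) [N.Normal] (hN : IsClosed (N : Set (FreeProP p n)))
    (v : FreeProP p n)
    (hv : ∀ k : Fin n, k ∉ K →
      CompletedGroupRing.quotientMap p N
        (foxDeriv p n k (CompletedGroupRing.of p (FreeProP p n) v)) = 0) :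
    v ∈ closure ((FreeProP.sub p n K : Set (FreeProP p n)) *
      (Subgroup.normalClosure
        ((FreeProP.sub p n K ⊓ N : Subgroup (FreeProP p n)) : Set (FreeProP p n)) :
          Set (FreeProP p n)) *
      ((⁅N, N⁆ : Subgroup (FreeProP p n)) : Set (FreeProP p n))) := by
  set H := FreeProP.sub p n K
  rw [mem_closure_iff]
  intro O hO hvO
  obtain ⟨W, hW⟩ := ProfiniteGrp.exist_openNormalSubgroup_sub_open_nhds_of_one
    (U := (fun g => v * g) ⁻¹' O) (hO.preimage (by fun_prop)) (by simpa using hvO)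
  obtain ⟨V, hVN, hVH⟩ := exists_openNormal_inf_le H N
    (Subgroup.isClosed_topologicalClosure _) hN W
  set U := V.preimage (QuotientGroup.mk' N) continuous_quotient_mk'
  obtain ⟨m, hm⟩ := ProPCompletion.exists_pow_mem W
  -- The exponent m + 1 instead of m ensures q = p ^ (m + 1) ≠ 1 even when m = 0.
  obtain ⟨f, hfv, hf⟩ := exists_of_approx v W U (m + 1)
  let L₀ := Subgroup.normalClosure ((H ⊓ N : Subgroup (FreeProP p n)) : Set (FreeProP p n)) ⊔
    ⁅N, N⁆
  have hNL : H ⊓ N ≤ L₀ := Subgroup.le_normalClosure.trans le_sup_left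
  have hcomm : ⁅U.toSubgroup, U.toSubgroup⁆ ≤ L₀ ⊔ W.toSubgroup := by
    refine (Subgroup.commutator_mono hVN hVN).trans ((commutator_sup_le N W.toSubgroup).trans ?_)
    exact sup_le_sup_right le_sup_right _
  -- The bound `hm` concerns only the discrete free group, but this group meets every coset of W.
  have hpow (u : FreeProP p n) : u ^ p ^ (m + 1) ∈ W.toSubgroup := by
    obtain ⟨g, hg⟩ := ProPCompletion.mk_of_surjective W (u : FreeProP p n ⧸ W.toSubgroup)
    have h1 := (QuotientGroup.eq_one_iff _).2 (hm g)
    rw [← QuotientGroup.eq_one_iff, pow_succ, pow_mul, QuotientGroup.mk_pow, QuotientGroup.mk_pow,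
      ← hg, QuotientGroup.mk'_apply, ← QuotientGroup.mk_pow, h1, one_pow]
  obtain ⟨h, hh, hfh⟩ := mem_mul_of_dvd_foxWord (ProPCompletion.of p (FreeGroup (Fin n))) H
    U.toSubgroup (L₀ ⊔ W.toSubgroup) (p ^ (m + 1))
    (Nat.one_lt_pow (Nat.succ_ne_zero m) (Fact.out : p.Prime).one_lt).ne'
    (hVH.trans (sup_le_sup_right hNL _)) hcomm (fun u _ => Subgroup.mem_sup_right (hpow u)) K
    (fun k hk => Subgroup.le_topologicalClosure _ (Subgroup.subset_closure ⟨k, hk, rfl⟩)) f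
    (fun k hk y => by
      have := hf k (CompletedGroupRing.apply_preimage_eq_zero N (hv k hk) V) y
      exact_mod_cast this)
  -- Here f = l w h with l ∈ L₀ and w ∈ W. Moving h to the left conjugates l and w inside normal
  -- subgroups, giving f = h a b (h⁻¹ w h) with the factors in the order of the product in the
  -- statement.
  obtain ⟨l, hl, w, hw, e⟩ := Subgroup.mem_sup_of_normal_right.1 hfh
  have hl' : h⁻¹ * l * h ∈ L₀ := by
    simpa using Subgroup.Normal.conj_mem inferInstance l hl h⁻¹
  have hw' : h⁻¹ * w * h ∈ W.toSubgroup := by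
    simpa using Subgroup.Normal.conj_mem inferInstance w hw h⁻¹
  obtain ⟨a, ha, b, hb, hab⟩ := Subgroup.mem_sup_of_normal_right.1 hl'
  refine ⟨h * a * b, ?_, Set.mul_mem_mul (Set.mul_mem_mul hh ha) hb⟩
  have hmem : v⁻¹ * (h * a * b) ∈ W.toSubgroup := by
    rw [← inv_mem_iff]
    convert W.toSubgroup.mul_mem hw' hfv using 1
    rw [mul_assoc h, hab, mul_inv_eq_iff_eq_mul.1 e.symm]
    group
  have := hW hmem
  rwa [Set.mem_preimage, mul_inv_cancel_left] at this
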